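/- **Corollary (The Reverse Post Correspondence Problem is undecidable).** An instance of the Reverse Post Correspondence Problem (RPCP) consists of a natural number $s$ and two finite lists $v_1,\ldots,v_p$ and $w_1,\ldots,w_p$ of words (possibly empty) over the alphabet $\Sigma=\{1,\ldots,s\}$. The problem asks whether there is a non-empty finite sequence $i_1,i_2,\ldots,i_k$ of indices with $1\le i_j\le p$ such that $$v_{i_k}v_{i_{k-1}}\cdots v_{i_1}=w_{i_k}w_{i_{k-1}}\cdots w_{i_1}.$$ The RPCP is undecidable: there is no algorithm (computable function) that, given an arbitrary instance, decides whether such a sequence exists. -/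

import Mathlib

/-- `x = (s, [(v₁, w₁), …, (vₚ, wₚ)])` is well formed when all the words `vᵢ` and `wᵢ` are words
over the alphabet `{1, …, s}`. -/
def PCPWellFormed (x : ℕ × List (List ℕ × List ℕ)) : Prop :=
  ∀ q ∈ x.2, (∀ t ∈ q.1, 1 ≤ t ∧ t ≤ x.1) ∧ (∀ t ∈ q.2, 1 ≤ t ∧ t ≤ x.1)

/-- The instances common to the Post Correspondence Problem and its reverse: an alphabet size `s`
and two finite lists `v₁, …, vₚ` and `w₁, …, wₚ`, of the same length, of words over `{1, …, s}`,
given as the list of pairs `(vᵢ, wᵢ)`. -/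
def PCPInstance : Type := {x : ℕ × List (List ℕ × List ℕ) // PCPWellFormed x}

instance PCPWellFormed.decidablePred : DecidablePred PCPWellFormed := fun x => by
  unfold PCPWellFormed
  infer_instance

theorem PCPWellFormed.primrecPred : PrimrecPred PCPWellFormed := by
  have hle : PrimrecRel fun (t s : ℕ) => 1 ≤ t ∧ t ≤ s :=
    (Primrec.nat_le.comp (Primrec.const 1) Primrec.fst).and
      (Primrec.nat_le.comp Primrec.fst Primrec.snd)
  have hw : PrimrecRel fun (u : List ℕ) (s : ℕ) => ∀ t ∈ u, 1 ≤ t ∧ t ≤ s := hle.forall_mem_list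
  have hq : PrimrecRel fun (q : List ℕ × List ℕ) (s : ℕ) =>
      (∀ t ∈ q.1, 1 ≤ t ∧ t ≤ s) ∧ (∀ t ∈ q.2, 1 ≤ t ∧ t ≤ s) :=
    (hw.comp (Primrec.fst.comp Primrec.fst) Primrec.snd).and
      (hw.comp (Primrec.snd.comp Primrec.fst) Primrec.snd)
  exact hq.forall_mem_list.comp Primrec.snd Primrec.fst

/-- Instances carry the standard encoding, as a primitive recursive subtype of
`ℕ × List (List ℕ × List ℕ)`. -/
instance PCPInstance.primcodable : Primcodable PCPInstance :=
  Primcodable.subtype PCPWellFormed.primrecPred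

namespace PCPInstance

/-- The number `p` of pairs of an instance. -/
def size (φ : PCPInstance) : ℕ := φ.val.2.length

/-- The words `v₁, …, vₚ`, indexed by `Fin p`. -/
def v (φ : PCPInstance) (i : Fin φ.size) : List ℕ := (φ.val.2[i.val]'i.isLt).1

/-- The words `w₁, …, wₚ`, indexed by `Fin p`. -/
def w (φ : PCPInstance) (i : Fin φ.size) : List ℕ := (φ.val.2[i.val]'i.isLt).2

end PCPInstance

/-- Concatenation from right to left: for the index sequence `[i₁, i₂, …, iₖ]` this is the word
`u_{iₖ} … u_{i₂} u_{i₁}`. -/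
def reverseConcat {p : ℕ} (u : Fin p → List ℕ) (μ : List (Fin p)) : List ℕ :=
  (μ.reverse.map u).flatten

/-- The Reverse Post Correspondence Problem: is there a non-empty index sequence `i₁, …, iₖ` with
`v_{iₖ} … v_{i₁} = w_{iₖ} … w_{i₁}`? -/
def RPCP (φ : PCPInstance) : Prop :=
  ∃ μ : List (Fin φ.size), μ ≠ [] ∧ reverseConcat φ.v μ = reverseConcat φ.w μ

/-! Reversing an index sequence turns RPCP into the ordinary Post Correspondence Problem, so it
suffices to reduce a halting problem to tile matching. One fixed program simulates the `n`-th
program on input `0`, so its halting on `n` is undecidable (`exists_code_not_computablePred_dom`).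
That halting becomes halting of a fixed finite Turing machine on the digits of `n`
(`exists_machine_eval_dom_iff`), then derivability of a fixed word in a fixed finite semi-Thue
system (`derives_iff_eval_dom`), then matching of tiles (`tilesSolvable_iff_derives`). The input `n`
enters only the start tile, so computability of the whole reduction comes down to computing binary
digits. -/

/-! ### Tile sets over arbitrary alphabets -/

/-- The Post Correspondence Problem for a set `T` of tiles over an arbitrary alphabet. -/
def TilesSolvable {α : Type*} (T : Set (List α × List α)) : Prop :=
  ∃ A : List (List α × List α), A ≠ [] ∧ (∀ a ∈ A, a ∈ T) ∧
    (A.map Prod.fst).flatten = (A.map Prod.snd).flatten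

theorem rpcp_iff_tilesSolvable (φ : PCPInstance) :
    RPCP φ ↔ TilesSolvable {a | a ∈ φ.val.2} := by
  constructor
  · rintro ⟨μ, hμ, h⟩
    refine ⟨μ.reverse.map fun i => φ.val.2[i.val]'i.isLt, by simpa using hμ, ?_, ?_⟩
    · intro a ha
      obtain ⟨i, -, rfl⟩ := List.mem_map.1 ha
      exact List.getElem_mem _
    · rw [List.map_map, List.map_map]
      exact h
  · rintro ⟨A, hA, hT, h⟩
    have hA' : ∃ μ : List (Fin φ.size), μ.map (fun i => φ.val.2[i.val]'i.isLt) = A := by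
      clear hA h
      induction A with
      | nil => exact ⟨[], rfl⟩
      | cons a A ih =>
        obtain ⟨μ, rfl⟩ := ih fun b hb => hT b (List.mem_cons_of_mem _ hb)
        obtain ⟨i, hi, rfl⟩ := List.mem_iff_getElem.1 (hT a List.mem_cons_self)
        exact ⟨⟨i, hi⟩ :: μ, rfl⟩
    obtain ⟨μ, rfl⟩ := hA'
    refine ⟨μ.reverse, by simpa using hA, ?_⟩
    rw [List.map_map, List.map_map] at h
    unfold reverseConcat
    rw [List.reverse_reverse]
    exact h

theorem tilesSolvable_map_iff {α β : Type*} {e : α → β} (he : Function.Injective e)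
    (T : Set (List α × List α)) :
    TilesSolvable (Prod.map (List.map e) (List.map e) '' T) ↔ TilesSolvable T := by
  have key (A : List (List α × List α)) :
      ((A.map (Prod.map (List.map e) (List.map e))).map Prod.fst).flatten =
          ((A.map (Prod.map (List.map e) (List.map e))).map Prod.snd).flatten ↔
        (A.map Prod.fst).flatten = (A.map Prod.snd).flatten := by
    have h1 : Prod.fst ∘ Prod.map (List.map e) (List.map e) = List.map e ∘ Prod.fst := rfl
    have h2 : Prod.snd ∘ Prod.map (List.map e) (List.map e) = List.map e ∘ Prod.snd := rfl
    rw [List.map_map, List.map_map, h1, h2, ← List.map_map, ← List.map_map, ← List.map_flatten,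
      ← List.map_flatten, (List.map_injective_iff.2 he).eq_iff]
  constructor
  · rintro ⟨A, hA, hT, h⟩
    have hA' : ∃ B : List (List α × List α), (∀ b ∈ B, b ∈ T) ∧
        B.map (Prod.map (List.map e) (List.map e)) = A := by
      clear hA h
      induction A with
      | nil => exact ⟨[], by simp, rfl⟩
      | cons a A ih =>
        obtain ⟨B, hB, rfl⟩ := ih fun b hb => hT b (List.mem_cons_of_mem _ hb)
        obtain ⟨b, hb, rfl⟩ := hT a List.mem_cons_self
        exact ⟨b :: B, by simpa [hb] using hB, rfl⟩
    obtain ⟨B, hB, rfl⟩ := hA'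
    exact ⟨B, by simpa using hA, hB, (key B).1 h⟩
  · rintro ⟨A, hA, hT, h⟩
    refine ⟨A.map (Prod.map (List.map e) (List.map e)), by simpa using hA, ?_, (key A).2 h⟩
    intro a ha
    obtain ⟨b, hb, rfl⟩ := List.mem_map.1 ha
    exact ⟨b, hT b hb, rfl⟩

/-! ### From semi-Thue systems to tiles -/

/-- One step of the semi-Thue system with rules `R`: replace a factor `l` by `r`, where `R l r`. -/
def SemiThueStep {α : Type*} (R : List α → List α → Prop) (x y : List α) : Prop :=
  ∃ p s l r, R l r ∧ x = p ++ l ++ s ∧ y = p ++ r ++ s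

/-- The alphabet of the tiles simulating a semi-Thue system: two copies of its letters, two copies
of a separator, and two brackets. -/
inductive TileSym (α : Type*)
  | letter (b : Bool) (a : α)
  | sep (b : Bool)
  | opening
  | closing

namespace TileSym

instance {α : Type*} [Finite α] : Finite (TileSym α) :=
  Finite.of_surjective
    (fun x : (Bool × α) ⊕ Bool ⊕ Bool => match x with
      | .inl (b, a) => letter b a
      | .inr (.inl b) => sep b
      | .inr (.inr true) => opening
      | .inr (.inr false) => closing)
    fun x => match x with
      | letter b a => ⟨.inl (b, a), rfl⟩
      | sep b => ⟨.inr (.inl b), rfl⟩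
      | opening => ⟨.inr (.inr true), rfl⟩
      | closing => ⟨.inr (.inr false), rfl⟩

end TileSym

open TileSym in
/-- The tile that starts a derivation from the word `u`. -/
def startTile {α : Type*} (u : List α) : List (TileSym α) × List (TileSym α) :=
  ([opening], opening :: (u.map (letter false) ++ [sep false]))

open TileSym in
/-- The tiles that carry out a derivation in the semi-Thue system `R` and finish it at the
word `t`. -/
inductive DerivationTile {α : Type*} (R : List α → List α → Prop) (t : List α) :
    List (TileSym α) × List (TileSym α) → Prop
  | copy (b : Bool) (a : α) : DerivationTile R t ([letter b a], [letter (!b) a])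
  | sep (b : Bool) : DerivationTile R t ([TileSym.sep b], [TileSym.sep (!b)])
  | rule (b : Bool) {l r : List α} (h : R l r) :
      DerivationTile R t (l.map (letter b), r.map (letter (!b)))
  | finish : DerivationTile R t (t.map (letter false) ++ [TileSym.sep false, closing], [closing])

section SemiThue

open TileSym Relation

variable {α : Type*} {R : List α → List α → Prop} {t : List α}

theorem finite_derivationTile [Finite α] (hR : {p : List α × List α | R p.1 p.2}.Finite) :
    {a | DerivationTile R t a}.Finite := by
  have h1 := Set.finite_range fun p : Bool × α =>
    (([letter p.1 p.2], [letter (!p.1) p.2]) : List (TileSym α) × List (TileSym α))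
  have h2 := Set.finite_range fun b : Bool =>
    (([TileSym.sep b], [TileSym.sep (!b)]) : List (TileSym α) × List (TileSym α))
  have h3 := (hR.image fun p => (p.1.map (letter false), p.2.map (letter true))).union
    (hR.image fun p => (p.1.map (letter true), p.2.map (letter false)))
  have h4 := Set.finite_singleton
    ((t.map (letter false) ++ [TileSym.sep false, closing], [closing]) :
      List (TileSym α) × List (TileSym α))
  refine (((h1.union h2).union h3).union h4).subset ?_
  intro a ha
  cases ha with
  | copy b a => exact .inl (.inl (.inl ⟨(b, a), rfl⟩))
  | sep b => exact .inl (.inl (.inr ⟨b, rfl⟩))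
  | rule b h =>
    cases b with
    | false => exact .inl (.inr (.inl ⟨(_, _), h, rfl⟩))
    | true => exact .inl (.inr (.inr ⟨(_, _), h, rfl⟩))
  | finish => exact .inr rfl

/-- A block of letters cannot run past a separator, so a tile top made of letters consumes a prefix
of the current word only. -/
theorem map_letter_append_eq {b b' : Bool} {l x : List α} {Y Z : List (TileSym α)}
    (h : l.map (letter b') ++ Y = x.map (letter b) ++ sep b :: Z) :
    ∃ x', x = l ++ x' ∧ (l ≠ [] → b' = b) ∧ Y = x'.map (letter b) ++ sep b :: Z := by
  induction l generalizing x with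
  | nil => exact ⟨x, rfl, by simp, h⟩
  | cons a l ih =>
    cases x with
    | nil => simp at h
    | cons c x =>
      simp only [List.map_cons, List.cons_append, List.cons.injEq, letter.injEq] at h
      obtain ⟨⟨rfl, rfl⟩, h⟩ := h
      obtain ⟨x', rfl, -, h⟩ := ih h
      exact ⟨x', rfl, fun _ => rfl, h⟩

/-- Invariant: the bottom row is ahead of the top row by the unread rest `x` of the current word, a
separator, and the part `y` of the next word already written in the other copy of the alphabet. The
word reached so far is `y ++ x`: rule tiles rewrite it, copy and separator tiles preserve it. -/
theorem derives_of_tiles {u : List α} (hR : ∀ l r, R l r → l ≠ [])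
    {A : List (List (TileSym α) × List (TileSym α))}
    (hA : ∀ a ∈ A, a = startTile u ∨ DerivationTile R t a) {b : Bool} {x y : List α}
    (h : (A.map Prod.fst).flatten =
      x.map (letter b) ++ sep b :: (y.map (letter (!b)) ++ (A.map Prod.snd).flatten)) :
    ReflTransGen (SemiThueStep R) (y ++ x) t := by
  induction A generalizing b x y with
  | nil => simp at h
  | cons a A ih =>
    have ih' := @ih fun c hc => hA c (List.mem_cons_of_mem _ hc)
    simp only [List.map_cons, List.flatten_cons] at h
    rcases hA a List.mem_cons_self with rfl | ha
    · cases x <;> simp [startTile] at h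
    · cases ha with
      | copy b' c =>
        cases x with
        | nil => simp at h
        | cons d x =>
          simp only [List.map_cons, List.cons_append, List.nil_append, List.cons.injEq,
            letter.injEq] at h
          obtain ⟨⟨rfl, rfl⟩, h⟩ := h
          simpa using ih' (x := x) (y := y ++ [c]) (b := b') (by simpa using h)
      | sep b' =>
        cases x with
        | cons d x => simp at h
        | nil =>
          simp only [List.map_nil, List.cons_append, List.nil_append, List.cons.injEq,
            sep.injEq] at h
          obtain ⟨rfl, h⟩ := h
          simpa using ih' (x := y) (y := []) (b := !b') (by simpa using h)
      | @rule b' l r hlr =>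
        obtain ⟨x', rfl, hb, h⟩ := map_letter_append_eq h
        obtain rfl := hb (hR _ _ hlr)
        have := ih' (x := x') (y := y ++ r) (b := b') (by simpa using h)
        exact ReflTransGen.head ⟨y, x', l, r, hlr, by simp, by simp⟩ this
      | finish =>
        rw [List.append_assoc] at h
        obtain ⟨x', rfl, -, h⟩ := map_letter_append_eq h
        cases x' with
        | cons d x => simp at h
        | nil =>
          -- The bracket `closing` must follow the separator at once, which forces `y` to be empty.
          cases y with
          | nil => simpa using ReflTransGen.refl
          | cons d y => simp at h

theorem exists_copy_tiles (b : Bool) (x : List α) :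
    ∃ A : List (List (TileSym α) × List (TileSym α)), (∀ a ∈ A, DerivationTile R t a) ∧
      (A.map Prod.fst).flatten = x.map (letter b) ∧
      (A.map Prod.snd).flatten = x.map (letter (!b)) := by
  refine ⟨x.map fun a => ([letter b a], [letter (!b) a]), ?_, ?_, ?_⟩
  · intro a ha
    obtain ⟨c, -, rfl⟩ := List.mem_map.1 ha
    exact .copy b c
  · induction x with
    | nil => rfl
    | cons a x ih => simpa using ih
  · induction x with
    | nil => rfl
    | cons a x ih => simpa using ih

/-- Each derivation step takes one full pass over the word, which flips the copy `b` of the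
alphabet. -/
theorem exists_tiles_of_derives {x : List α} (h : ReflTransGen (SemiThueStep R) x t) (b : Bool) :
    ∃ A : List (List (TileSym α) × List (TileSym α)), (∀ a ∈ A, DerivationTile R t a) ∧
      (A.map Prod.fst).flatten = x.map (letter b) ++ sep b :: (A.map Prod.snd).flatten := by
  induction h using ReflTransGen.head_induction_on generalizing b with
  | refl =>
    have key : ∃ A : List (List (TileSym α) × List (TileSym α)), (∀ a ∈ A, DerivationTile R t a) ∧
        (A.map Prod.fst).flatten =
          t.map (letter false) ++ sep false :: (A.map Prod.snd).flatten :=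
      ⟨[(t.map (letter false) ++ [TileSym.sep false, closing], [closing])],
        by simpa using DerivationTile.finish, by simp⟩
    cases b with
    | false => exact key
    -- The finishing tile is written in copy `false` only, so one more pass of pure copying corrects
    -- the parity.
    | true =>
      obtain ⟨A, hA, hA'⟩ := key
      obtain ⟨C, hC, h1, h2⟩ := exists_copy_tiles (R := R) (t := t) true t
      refine ⟨C ++ ([sep true], [sep false]) :: A, ?_, ?_⟩
      · simp only [List.mem_append, List.mem_cons]
        rintro a (ha | rfl | ha)
        exacts [hC a ha, .sep true, hA a ha]
      · simp [h1, h2, hA']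
  | head hxy _ ih =>
    obtain ⟨p, s, l, r, hlr, rfl, rfl⟩ := hxy
    obtain ⟨A, hA, hA'⟩ := ih (!b)
    obtain ⟨C, hC, h1, h2⟩ := exists_copy_tiles (R := R) (t := t) b p
    obtain ⟨D, hD, h3, h4⟩ := exists_copy_tiles (R := R) (t := t) b s
    refine ⟨C ++ (l.map (letter b), r.map (letter (!b))) :: (D ++ ([sep b], [sep (!b)]) :: A),
      ?_, ?_⟩
    · simp only [List.mem_append, List.mem_cons]
      rintro a (ha | rfl | ha | rfl | ha)
      exacts [hC a ha, .rule b hlr, hD a ha, .sep b, hA a ha]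
    · simp [h1, h2, h3, h4, hA']

/-- Derivability in a semi-Thue system whose rules have non-empty sides reduces to the Post
Correspondence Problem. -/
theorem tilesSolvable_iff_derives (hR : ∀ l r, R l r → l ≠ [] ∧ r ≠ []) (u : List α) :
    TilesSolvable (insert (startTile u) {a | DerivationTile R t a}) ↔
      ReflTransGen (SemiThueStep R) u t := by
  constructor
  · rintro ⟨A, hA, hT, h⟩
    cases A with
    | nil => exact absurd rfl hA
    | cons a A =>
      have hT' : ∀ c ∈ A, c = startTile u ∨ DerivationTile R t c :=
        fun c hc => hT c (List.mem_cons_of_mem _ hc)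
      simp only [List.map_cons, List.flatten_cons] at h
      rcases hT a List.mem_cons_self with rfl | ha
      · refine derives_of_tiles (fun l r h => (hR l r h).1) hT' (b := false) (x := u) (y := []) ?_
        simpa [startTile] using h
      -- No other tile can come first: its top and bottom begin with different symbols. This uses
      -- that both sides of a rule are non-empty.
      · exfalso
        cases ha with
        | copy b a => simp at h
        | sep b => simp at h
        | @rule b l r hlr =>
          obtain ⟨hl, hr⟩ := hR l r hlr
          cases l with
          | nil => exact hl rfl
          | cons c l =>
            cases r with
            | nil => exact hr rfl
            | cons d r => simp at h
        | finish => cases t <;> simp at h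
  · intro h
    obtain ⟨A, hA, h⟩ := exists_tiles_of_derives h false
    refine ⟨startTile u :: A, by simp, ?_, by simp [startTile, h]⟩
    intro a ha
    rcases List.mem_cons.1 ha with rfl | ha
    exacts [.inl rfl, .inr (hA a ha)]

end SemiThue

/-! ### From Turing machines to semi-Thue systems -/

/-- The letters of the words that describe the configurations of a Turing machine: two end markers,
the tape symbols, the states, and a letter that signals that the machine has halted. -/
inductive CfgLetter (Γ Q : Type*)
  | left
  | right
  | sym (a : Γ)
  | state (q : Q)
  | halted

namespace CfgLetter

variable {Γ Q : Type*}

instance [Finite Γ] [Finite Q] : Finite (CfgLetter Γ Q) :=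
  Finite.of_surjective
    (fun x : Γ ⊕ Q ⊕ Option Bool => match x with
      | .inl a => sym a
      | .inr (.inl q) => state q
      | .inr (.inr (some true)) => left
      | .inr (.inr (some false)) => right
      | .inr (.inr none) => halted)
    fun x => match x with
      | sym a => ⟨.inl a, rfl⟩
      | state q => ⟨.inr (.inl q), rfl⟩
      | left => ⟨.inr (.inr (some true)), rfl⟩
      | right => ⟨.inr (.inr (some false)), rfl⟩
      | halted => ⟨.inr (.inr none), rfl⟩

/-- The word describing the configuration with state `q`, tape `v` from the head to the right, and
tape `u` from the cell before the head to the left. -/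
def word (u : List Γ) (q : Q) (v : List Γ) : List (CfgLetter Γ Q) :=
  (u.map sym ++ [left]).reverse ++ state q :: (v.map sym ++ [right])

/-- Configuration words contain a single state letter, so a rule that mentions a state applies at
one place at most. -/
theorem append_state_inj {u v u' v' : List (CfgLetter Γ Q)} {q q' : Q}
    (hu : ∀ q, state q ∉ u) (hv : ∀ q, state q ∉ v)
    (h : u ++ state q :: v = u' ++ state q' :: v') : u = u' ∧ q = q' ∧ v = v' := by
  induction u generalizing u' with
  | nil =>
    cases u' with
    | nil => simpa using h
    | cons a u' =>
      simp only [List.nil_append, List.cons_append, List.cons.injEq] at h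
      exact absurd (by simp [h.2]) (hv q')
  | cons a u ih =>
    cases u' with
    | nil =>
      simp only [List.nil_append, List.cons_append, List.cons.injEq] at h
      exact absurd (by simp [h.1]) (hu q')
    | cons b u' =>
      simp only [List.cons_append, List.cons.injEq] at h
      obtain ⟨h1, h2, h3⟩ := ih (fun q hq => hu q (List.mem_cons_of_mem _ hq)) h.2
      exact ⟨by rw [h.1, h1], h2, h3⟩

theorem word_eq_append {u v : List Γ} {q q' : Q} {x y : List (CfgLetter Γ Q)}
    (h : word u q v = x ++ state q' :: y) :
    u.map sym ++ [left] = x.reverse ∧ q = q' ∧ v.map sym ++ [right] = y := by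
  obtain ⟨h1, h2, h3⟩ := append_state_inj (by simp) (by simp) h
  exact ⟨by rw [← h1, List.reverse_reverse], h2, h3⟩

theorem halted_notMem_word {u v : List Γ} {q : Q} : halted ∉ word u q v := by
  simp [word]

end CfgLetter

section TuringMachine

open Turing CfgLetter Relation

variable {Γ Λ : Type*} [Inhabited Γ] [Inhabited Λ]

/-- The semi-Thue system that simulates the Turing machine `M` on the states in `S`. -/
inductive MachineRule (M : TM0.Machine Γ Λ) (S : Set Λ) :
    List (CfgLetter Γ S) → List (CfgLetter Γ S) → Prop
  | extendLeft (q : S) : MachineRule M S [left, state q] [left, sym default, state q]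
  | extendRight (q : S) : MachineRule M S [state q, right] [state q, sym default, right]
  | write {q q' : S} {a b : Γ} (h : M q.1 a = some (q'.1, .write b)) :
      MachineRule M S [state q, sym a] [state q', sym b]
  | moveRight {q q' : S} {a : Γ} (h : M q.1 a = some (q'.1, .move .right)) :
      MachineRule M S [state q, sym a] [sym a, state q']
  | moveLeft {q q' : S} {a : Γ} (b : Γ) (h : M q.1 a = some (q'.1, .move .left)) :
      MachineRule M S [sym b, state q, sym a] [state q', sym b, sym a]
  | halt {q : S} {a : Γ} (h : M q.1 a = none) : MachineRule M S [state q, sym a] [halted]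
  | eraseLeft (a : Γ) : MachineRule M S [sym a, halted] [halted]
  | eraseRight (a : Γ) : MachineRule M S [halted, sym a] [halted]

variable {M : TM0.Machine Γ Λ} {S : Set Λ}

theorem MachineRule.ne_nil {l r : List (CfgLetter Γ S)} (h : MachineRule M S l r) :
    l ≠ [] ∧ r ≠ [] := by
  cases h <;> simp

theorem finite_machineRule [Finite Γ] (hS : S.Finite) :
    {p : List (CfgLetter Γ S) × List (CfgLetter Γ S) | MachineRule M S p.1 p.2}.Finite := by
  have := hS.to_subtype
  -- Both sides of every rule have length at most three over a finite alphabet.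
  refine ((List.finite_length_le (CfgLetter Γ S) 3).prod
    (List.finite_length_le (CfgLetter Γ S) 3)).subset ?_
  rintro ⟨l, r⟩ (h : MachineRule M S l r)
  cases h <;> simp

theorem Turing.ListBlank.mk_singleton_default :
    ListBlank.mk [(default : Γ)] = ListBlank.mk [] := by
  have := ListBlank.cons_head_tail (ListBlank.mk ([] : List Γ))
  rwa [ListBlank.tail_mk, ListBlank.head_mk, ListBlank.cons_mk] at this

theorem eval_dom_of_step {σ : Type*} {f : σ → Option σ} {c c' : σ} (h : f c = some c')
    (h' : (StateTransition.eval f c').Dom) : (StateTransition.eval f c).Dom := by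
  rwa [StateTransition.reaches_eval (ReflTransGen.single h)]

theorem eval_dom_of_step_eq_none {σ : Type*} {f : σ → Option σ} {c : σ} (h : f c = none) :
    (StateTransition.eval f c).Dom :=
  Part.dom_iff_mem.2 ⟨c, StateTransition.mem_eval.2 ⟨.refl, h⟩⟩

/-- A rule applied to a configuration word either adds a blank, which leaves the tape unchanged, or
performs the machine step, or introduces `halted`, which requires that the machine has stopped. The
erasing rules need `halted` to be present already. -/
theorem eval_dom_of_derives {w : List (CfgLetter Γ S)}
    (h : ReflTransGen (SemiThueStep (MachineRule M S)) w [left, halted, right])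
    {u v : List Γ} {q : S} (hw : w = word u q v) :
    (StateTransition.eval (TM0.step M)
      ⟨q.1, Tape.mk' (ListBlank.mk u) (ListBlank.mk v)⟩).Dom := by
  induction h using ReflTransGen.head_induction_on generalizing u v q with
  | refl => exact absurd (by simp) (hw ▸ halted_notMem_word (u := u) (v := v) (q := q))
  | head hxy _ ih =>
    obtain ⟨p, s, l, r, hlr, rfl, rfl⟩ := hxy
    cases hlr with
    | extendLeft q₁ =>
      obtain ⟨h1, rfl, h2⟩ := word_eq_append (x := p ++ [left]) (y := s) (by simpa using hw.symm)
      cases u with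
      | cons a u => simp at h1
      | nil =>
        have := ih (u := [default]) (v := v) (q := q) (by
          have : p = [] := by simpa using h1
          simp [word, ← h2, this])
        rwa [ListBlank.mk_singleton_default] at this
    | extendRight q₁ =>
      obtain ⟨h1, rfl, h2⟩ := word_eq_append (x := p) (y := right :: s) (by simpa using hw.symm)
      cases v with
      | cons a v => simp at h2
      | nil =>
        have := ih (u := u) (v := [default]) (q := q) (by
          have : s = [] := by simpa using h2.symm
          simp [word, h1, this])
        rwa [ListBlank.mk_singleton_default] at this
    | @write q₁ q' a b h =>
      obtain ⟨h1, rfl, h2⟩ := word_eq_append (x := p) (y := sym a :: s) (by simpa using hw.symm)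
      cases v with
      | nil => simp at h2
      | cons c v =>
        simp only [List.map_cons, List.cons_append, List.cons.injEq, sym.injEq] at h2
        obtain ⟨rfl, h2⟩ := h2
        refine eval_dom_of_step ?_ (ih (u := u) (v := b :: v) (q := q') ?_)
        · simp [TM0.step, h, ← ListBlank.cons_mk]
        · simp [word, h1, ← h2]
    | @moveRight q₁ q' a h =>
      obtain ⟨h1, rfl, h2⟩ := word_eq_append (x := p) (y := sym a :: s) (by simpa using hw.symm)
      cases v with
      | nil => simp at h2
      | cons c v =>
        simp only [List.map_cons, List.cons_append, List.cons.injEq, sym.injEq] at h2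
        obtain ⟨rfl, h2⟩ := h2
        refine eval_dom_of_step ?_ (ih (u := c :: u) (v := v) (q := q') ?_)
        · simp [TM0.step, h, ← ListBlank.cons_mk]
        · simp [word, h1, ← h2]
    | @moveLeft q₁ q' a b h =>
      obtain ⟨h1, rfl, h2⟩ := word_eq_append (x := p ++ [sym b]) (y := sym a :: s)
        (by simpa using hw.symm)
      cases v with
      | nil => simp at h2
      | cons c v =>
        cases u with
        | nil => simp at h1
        | cons d u =>
          simp only [List.map_cons, List.cons_append, List.cons.injEq, sym.injEq] at h2
          obtain ⟨rfl, h2⟩ := h2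
          simp only [List.map_cons, List.cons_append, List.reverse_append, List.reverse_cons,
            List.reverse_nil, List.nil_append, List.cons.injEq, sym.injEq] at h1
          obtain ⟨rfl, h1⟩ := h1
          refine eval_dom_of_step ?_ (ih (u := u) (v := d :: c :: v) (q := q') ?_)
          · simp [TM0.step, h, ← ListBlank.cons_mk]
          · simp [word, h1, ← h2]
    | @halt q₁ a h =>
      obtain ⟨h1, rfl, h2⟩ := word_eq_append (x := p) (y := sym a :: s) (by simpa using hw.symm)
      cases v with
      | nil => simp at h2
      | cons c v =>
        simp only [List.map_cons, List.cons_append, List.cons.injEq, sym.injEq] at h2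
        obtain ⟨rfl, h2⟩ := h2
        exact eval_dom_of_step_eq_none (by simp [TM0.step, h, ← ListBlank.cons_mk])
    | eraseLeft a =>
      exact absurd (by simp) (hw ▸ halted_notMem_word (u := u) (v := v) (q := q))
    | eraseRight a =>
      exact absurd (by simp) (hw ▸ halted_notMem_word (u := u) (v := v) (q := q))

theorem derives_of_halted (u v : List Γ) :
    ReflTransGen (SemiThueStep (MachineRule M S))
      ((u.map sym ++ [left]).reverse ++ halted :: (v.map sym ++ [right]))
      [left, halted, right] := by
  induction u with
  | nil =>
    induction v with
    | nil => exact .refl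
    | cons a v ih =>
      refine .head ⟨[left], v.map sym ++ [right], _, _, .eraseRight a, ?_, ?_⟩ ih <;> simp
  | cons a u ih =>
    refine .head ⟨(u.map sym ++ [left]).reverse, v.map sym ++ [right], _, _, .eraseLeft a,
      ?_, ?_⟩ ih <;> simp

/-- The tape determines `u` and `v` only up to trailing blanks, so the induction ranges over all
representing lists. The rules for `M` read a symbol to the right of the state; if `v` is empty, a
blank is supplied first. -/
theorem derives_of_reaches (hS : TM0.Supports M S) {c c' : TM0.Cfg Γ Λ}
    (h : ReflTransGen (fun a b => b ∈ TM0.step M a) c c') (hc' : TM0.step M c' = none)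
    {u v : List Γ} {q : S} (hc : c = ⟨q.1, Tape.mk' (ListBlank.mk u) (ListBlank.mk v)⟩) :
    ReflTransGen (SemiThueStep (MachineRule M S)) (word u q v) [left, halted, right] := by
  induction h using ReflTransGen.head_induction_on generalizing u v q with
  | refl =>
    have key (a : Γ) (v : List Γ)
        (hc : c' = ⟨q.1, Tape.mk' (ListBlank.mk u) (ListBlank.mk (a :: v))⟩) :
        ReflTransGen (SemiThueStep (MachineRule M S)) (word u q (a :: v))
          [left, halted, right] := by
      subst hc
      have h : M q.1 a = none := by simpa [TM0.step] using hc'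
      refine .head ⟨(u.map sym ++ [left]).reverse, v.map sym ++ [right], _, _, .halt h, ?_, rfl⟩ ?_
      · simp [word]
      · simpa using derives_of_halted u v
    cases v with
    | cons a v => exact key a v hc
    | nil =>
      refine .head ⟨(u.map sym ++ [left]).reverse, [], _, _, .extendRight q, ?_, rfl⟩ ?_
      · simp [word]
      · simpa [word] using key default [] (by rw [hc, ListBlank.mk_singleton_default])
  | @head c d hcd _ ih =>
    have key (a : Γ) (v : List Γ)
        (hc : c = ⟨q.1, Tape.mk' (ListBlank.mk u) (ListBlank.mk (a :: v))⟩) :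
        ReflTransGen (SemiThueStep (MachineRule M S)) (word u q (a :: v))
          [left, halted, right] := by
      subst hc
      obtain ⟨⟨q', s⟩, h, hd⟩ := Option.map_eq_some_iff.1 hcd
      have h : M q.1 a = some (q', s) := by simpa using h
      obtain ⟨q', rfl⟩ : ∃ x : S, x.1 = q' := ⟨⟨q', hS.2 h q.2⟩, rfl⟩
      cases s with
      | write b =>
        refine .head ⟨(u.map sym ++ [left]).reverse, v.map sym ++ [right], _, _, .write h, ?_, rfl⟩
          ?_
        · simp [word]
        · simpa [word] using ih (u := u) (v := b :: v) (q := q')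
            (by simp [← hd, ← ListBlank.cons_mk])
      | move dir =>
        cases dir with
        | right =>
          refine .head ⟨(u.map sym ++ [left]).reverse, v.map sym ++ [right], _, _, .moveRight h,
            ?_, rfl⟩ ?_
          · simp [word]
          · simpa [word] using ih (u := a :: u) (v := v) (q := q')
              (by simp [← hd, ← ListBlank.cons_mk])
        | left =>
          cases u with
          | cons b u =>
            refine .head ⟨(u.map sym ++ [left]).reverse, v.map sym ++ [right], _, _,
              .moveLeft b h, ?_, rfl⟩ ?_
            · simp [word]
            · simpa [word] using ih (u := u) (v := b :: a :: v) (q := q')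
                (by simp [← hd, ← ListBlank.cons_mk])
          | nil =>
            -- A left move at the left marker needs a blank inserted first.
            refine .head ⟨[], sym a :: v.map sym ++ [right], _, _, .extendLeft q, ?_, rfl⟩ ?_
            · simp [word]
            refine .head ⟨[left], v.map sym ++ [right], _, _, .moveLeft default h, ?_, rfl⟩ ?_
            · simp
            · simpa [word] using ih (u := []) (v := default :: a :: v) (q := q')
                (by simp [← hd, ← ListBlank.cons_mk])
    cases v with
    | cons a v => exact key a v hc
    | nil =>
      refine .head ⟨(u.map sym ++ [left]).reverse, [], _, _, .extendRight q, ?_, rfl⟩ ?_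
      · simp [word]
      · simpa [word] using key default [] (by rw [hc, ListBlank.mk_singleton_default])

/-- The halting problem of a Turing machine reduces to derivability in a semi-Thue system. -/
theorem derives_iff_eval_dom (hS : TM0.Supports M S) (l : List Γ) :
    ReflTransGen (SemiThueStep (MachineRule M S)) (word [] ⟨default, hS.1⟩ l)
      [left, halted, right] ↔ (TM0.eval M l).Dom := by
  constructor
  · intro h
    exact eval_dom_of_derives h rfl
  · intro h
    have h' : (StateTransition.eval (TM0.step M) (TM0.init l)).Dom := h
    obtain ⟨c, hc⟩ := Part.dom_iff_mem.1 h'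
    obtain ⟨h1, h2⟩ := StateTransition.mem_eval.1 hc
    exact derives_of_reaches hS h1 h2 rfl

end TuringMachine

/-! ### A fixed machine and computable instances -/

section Undecidable

open Turing Relation

theorem exists_code_not_computablePred_dom :
    ∃ c : ToPartrec.Code, ¬ ComputablePred fun n : ℕ => (c.eval [n]).Dom := by
  have hf : Partrec fun n : ℕ => Nat.Partrec.Code.eval (Denumerable.ofNat Nat.Partrec.Code n) 0 :=
    Nat.Partrec.Code.eval_part.comp (Computable.ofNat _) (Computable.const 0)
  obtain ⟨c, hc⟩ := ToPartrec.Code.exists_code (Nat.Partrec'.part_iff₁.2 hf)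
  refine ⟨c, fun h => ComputablePred.halting_problem 0 ?_⟩
  refine ComputablePred.computable_of_manyOneReducible
    ⟨Encodable.encode, Computable.encode, fun d => ?_⟩ h
  have := hc ⟨[Encodable.encode d], rfl⟩
  change c.eval [Encodable.encode d] = _ at this
  rw [this]
  simp [List.Vector.head]

instance : Finite PartrecToTM2.K' :=
  Finite.of_surjective (fun x : Option (Option Bool) => match x with
    | none => PartrecToTM2.K'.main
    | some none => .rev
    | some (some true) => .aux
    | some (some false) => .stack)
    fun x => match x with
      | .main => ⟨none, rfl⟩
      | .rev => ⟨some none, rfl⟩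
      | .aux => ⟨some (some true), rfl⟩
      | .stack => ⟨some (some false), rfl⟩

theorem trNat_eq (n : ℕ) : PartrecToTM2.trNat n =
    if n = 0 then [] else
      (if n % 2 = 0 then PartrecToTM2.Γ'.bit0 else PartrecToTM2.Γ'.bit1) ::
        PartrecToTM2.trNat (n / 2) := by
  split_ifs with h0 h1
  · rw [h0, PartrecToTM2.trNat_zero]
  · obtain ⟨m, rfl⟩ : ∃ m, n = Nat.bit false m := ⟨n / 2, by simp [Nat.bit]; omega⟩
    have hm : Nat.bit false m / 2 = m := by simp [Nat.bit]
    have hm0 : m ≠ 0 := by rintro rfl; simp at h0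
    rw [hm]
    unfold PartrecToTM2.trNat
    rw [← Num.ofNat'_eq, ← Num.ofNat'_eq, Num.ofNat'_bit]
    cases h : Num.ofNat' m with
    | zero =>
      rw [Num.ofNat'_eq] at h
      exact absurd (by simpa using congrArg (fun k : Num => (k : ℕ)) h) hm0
    | pos p => rfl
  · obtain ⟨m, rfl⟩ : ∃ m, n = Nat.bit true m := ⟨n / 2, by simp [Nat.bit]; omega⟩
    have hm : Nat.bit true m / 2 = m := by simp [Nat.bit]; omega
    rw [hm]
    unfold PartrecToTM2.trNat
    rw [← Num.ofNat'_eq, ← Num.ofNat'_eq, Num.ofNat'_bit]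
    cases h : Num.ofNat' m with
    | zero => rfl
    | pos p => rfl

theorem primrec_map_trNat (e : PartrecToTM2.Γ' → ℕ) :
    Primrec fun n => (PartrecToTM2.trNat n).map e := by
  -- Strong recursion along `n ↦ n / 2`: `l` lists the values at all arguments below `n`, so
  -- `l.length` is `n`.
  have hg : Primrec₂ fun (_ : Unit) (l : List (List ℕ)) =>
      if l.length = 0 then some [] else
        (l[l.length / 2]?).map fun x =>
          (if l.length % 2 = 0 then e .bit0 else e .bit1) :: x := by
    have hlen : Primrec fun p : Unit × List (List ℕ) => p.2.length :=
      Primrec.list_length.comp Primrec.snd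
    refine Primrec.ite (Primrec.eq.comp hlen (Primrec.const 0)) (Primrec.const _) ?_
    refine Primrec.option_map
      (Primrec.list_getElem?.comp Primrec.snd (Primrec.nat_div.comp hlen (Primrec.const 2))) ?_
    refine Primrec.list_cons.comp (Primrec.ite ?_ (Primrec.const _) (Primrec.const _)) Primrec.snd
    exact Primrec.eq.comp
      (Primrec.nat_mod.comp (hlen.comp Primrec.fst) (Primrec.const 2)) (Primrec.const 0)
  have := Primrec.nat_strong_rec (fun (_ : Unit) n => (PartrecToTM2.trNat n).map e) hg fun _ n => by
    rw [trNat_eq n]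
    by_cases h0 : n = 0
    · simp [h0]
    · have : n / 2 < n := Nat.div_lt_self (Nat.pos_of_ne_zero h0) one_lt_two
      simp [h0, this, apply_ite e]
  exact this.comp (Primrec.const ()) Primrec.id

/-- Halting of a program on input `n` is halting of a fixed Turing machine with finitely many states,
on a tape that holds the binary digits of `n`. -/
theorem exists_machine_eval_dom_iff (c : ToPartrec.Code) :
    ∃ (Γ Λ : Type) (_ : Inhabited Γ) (_ : Inhabited Λ) (M : TM0.Machine Γ Λ) (S : Set Λ)
      (a : Γ) (f : PartrecToTM2.Γ' → Γ), Finite Γ ∧ S.Finite ∧ TM0.Supports M S ∧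
        ∀ n : ℕ, (TM0.eval M (a :: ((PartrecToTM2.trNat n).map f).reverse)).Dom ↔
          (c.eval [n]).Dom := by
  -- Machines start in the `default` state, so this instance is what makes the machine run `c`.
  let _ : Inhabited PartrecToTM2.Λ' := ⟨PartrecToTM2.trNormal c .halt⟩
  have h1 : TM2.Supports PartrecToTM2.tr (PartrecToTM2.codeSupp c .halt) :=
    PartrecToTM2.tr_supports c .halt
  have h2 := TM2to1.tr_supports PartrecToTM2.tr h1
  have h3 := TM1to0.tr_supports _ h2
  have := Fintype.ofFinite PartrecToTM2.K'
  have hΓ : Finite (TM2to1.Γ' PartrecToTM2.K' fun _ => PartrecToTM2.Γ') :=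
    Finite.of_fintype _
  refine ⟨TM2to1.Γ' PartrecToTM2.K' fun _ => PartrecToTM2.Γ', _, TM2to1.Γ'.inhabited, _, _, _,
    -- The bottom cell of the main stack: it carries the bottom mark `true` and the terminator
    -- `cons` of the input. The digits lie above it, hence the reversal.
    (true, Function.update (fun _ => none) PartrecToTM2.K'.main (some PartrecToTM2.Γ'.cons)),
    fun a => (false, Function.update (fun _ => none) PartrecToTM2.K'.main (some a)),
    hΓ, Finset.finite_toSet _, h3, fun n => ?_⟩
  rw [TM1to0.tr_eval]
  have hl := TM2to1.tr_eval_dom PartrecToTM2.tr PartrecToTM2.K'.main (PartrecToTM2.trList [n])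
  have hi : TM2to1.trInit PartrecToTM2.K'.main (PartrecToTM2.trList [n]) =
    ((true, Function.update (fun _ => none) PartrecToTM2.K'.main (some PartrecToTM2.Γ'.cons)) ::
      ((PartrecToTM2.trNat n).map fun a => ((false, Function.update (fun _ => none)
        PartrecToTM2.K'.main (some a)) :
          TM2to1.Γ' PartrecToTM2.K' fun _ => PartrecToTM2.Γ')).reverse) := by
    simp only [TM2to1.trInit, PartrecToTM2.trList, List.reverse_append, List.reverse_cons,
      List.reverse_nil, List.nil_append, List.cons_append]
    rw [← List.map_reverse]
    rfl
  rw [hi] at hl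
  refine hl.trans ?_
  have he : TM2.init PartrecToTM2.K'.main (PartrecToTM2.trList [n]) =
      PartrecToTM2.init c [n] := by
    unfold TM2.init PartrecToTM2.init
    congr 1
    funext k
    cases k <;> rfl
  change (StateTransition.eval (TM2.step PartrecToTM2.tr) (TM2.init _ _)).Dom ↔ _
  rw [he, PartrecToTM2.tr_eval]
  rfl

/-- A Post correspondence problem in which one tile ends in a word read from the input. -/
theorem exists_primrec_instance {β : Type*} [Finite β] {T : Set (List β × List β)}
    (hT : T.Finite) (x y z : List β) (f : PartrecToTM2.Γ' → β) :
    ∃ g : ℕ → PCPInstance, Primrec g ∧ ∀ n, RPCP (g n) ↔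
      TilesSolvable (insert (x, y ++ ((PartrecToTM2.trNat n).map f).reverse ++ z) T) := by
  obtain ⟨s, ⟨d⟩⟩ := Finite.exists_equiv_fin β
  -- The shift by one makes the letters `1, …, s`.
  set e : β → ℕ := fun b => (d b).val + 1 with he
  have hinj : Function.Injective e := fun a b h => d.injective (Fin.ext (by simpa [he] using h))
  have hmem (l : List β) : ∀ t ∈ l.map e, 1 ≤ t ∧ t ≤ s := by
    intro t ht
    obtain ⟨b, -, rfl⟩ := List.mem_map.1 ht
    exact ⟨Nat.succ_le_succ (Nat.zero_le _), (d b).isLt⟩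
  set E : List β × List β → List ℕ × List ℕ := Prod.map (List.map e) (List.map e) with hE
  let L (n : ℕ) : List (List β × List β) :=
    (x, y ++ ((PartrecToTM2.trNat n).map f).reverse ++ z) :: hT.toFinset.toList
  have hwf (n : ℕ) : PCPWellFormed (s, (L n).map E) := by
    intro q hq
    obtain ⟨r, -, rfl⟩ := List.mem_map.1 hq
    exact ⟨hmem r.1, hmem r.2⟩
  let g (n : ℕ) : PCPInstance := ⟨(s, (L n).map E), hwf n⟩
  refine ⟨g, ?_, fun n => ?_⟩
  · refine Primrec.subtype_mk (hp := PCPWellFormed.primrecPred) (h := hwf) ?_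
    have hL (n : ℕ) : (L n).map E =
        (x.map e, y.map e ++ (((PartrecToTM2.trNat n).map (e ∘ f)).reverse ++ z.map e)) ::
          hT.toFinset.toList.map E := by
      simp [L, hE]
    simp only [hL]
    refine Primrec.pair (Primrec.const _) (Primrec.list_cons.comp (Primrec.pair (Primrec.const _) ?_)
      (Primrec.const _))
    exact Primrec.list_append.comp (Primrec.const _) (Primrec.list_append.comp
      (Primrec.list_reverse.comp (primrec_map_trNat _)) (Primrec.const _))
  · rw [rpcp_iff_tilesSolvable, ← tilesSolvable_map_iff hinj]
    congr! 1
    ext a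
    simp [g, L, hE, eq_comm (a := a)]

end Undecidable

/-- The Reverse Post Correspondence Problem is undecidable. -/
theorem mainTheorem2 : ¬ ComputablePred RPCP := by
  intro hdec
  obtain ⟨c, hc⟩ := exists_code_not_computablePred_dom
  obtain ⟨Γ, Λ, _, _, M, S, a, f, _, hS, hMS, hM⟩ := exists_machine_eval_dom_iff c
  have := hS.to_subtype
  obtain ⟨g, hg, hgn⟩ := exists_primrec_instance
    (finite_derivationTile (t := [CfgLetter.left, CfgLetter.halted, CfgLetter.right])
      (finite_machineRule (M := M) hS))
    -- The start tile for the initial configuration, cut around the digits of the input.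
    [TileSym.opening]
    [.opening, .letter false .left, .letter false (.state ⟨default, hMS.1⟩),
      .letter false (.sym a)]
    [.letter false .right, .sep false] (fun b => .letter false (.sym (f b)))
  refine hc (ComputablePred.computable_of_manyOneReducible ⟨g, hg.to_comp, fun n => ?_⟩ hdec)
  change (c.eval [n]).Dom ↔ _
  rw [hgn, ← hM, ← derives_iff_eval_dom hMS,
    ← tilesSolvable_iff_derives fun _ _ h => h.ne_nil]
  simp [startTile, CfgLetter.word, Function.comp_def]
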